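/- Let $\mathcal H$ be a (positive-definite) Hilbert space, with inner product $\langle\cdot,\cdot\rangle$ antilinear in the first argument, carrying a relativistic quantum field theory in the sense of Wightman, with vacuum $\Psi_0$, and let $\phi$ be a Hermitean scalar Wightman field of this theory on $\mathbb R^4$ (the theory may contain further fields; $\Psi_0$ need not be cyclic for $\phi$). Let $m>0$ and let $j(x)=(-\partial_\nu\partial^\nu-m^2)\phi(x)$ be the current. Let $f\mapsto\phi^{\rm in}(f)\Psi_0$ and $f\mapsto\phi^{\rm out}(f)\Psi_0$ be two continuous linear maps from $\mathcal S(\mathbb R^4)$ to $\mathcal H$. For $\Psi\in\mathcal H$ consider the tempered distributions $$\hat w(k)=\int e^{ix\cdot k}\langle j(x)\Psi_0,\Psi\rangle\,dx,\qquad \hat W^{\,\cdot\,}(k)=\int e^{ix\cdot k}\langle \phi^{\,\cdot\,}(x)\Psi_0,\Psi\rangle\,dx,$$ where $\hat W,\hat W^{\rm in},\hat W^{\rm out}$ belong to $\phi,\phi^{\rm in},\phi^{\rm out}$, and $x\cdot k=x^0k^0-\mathbf x\cdot\mathbf k$. Suppose that for all $\Psi$ in some dense subset of $\mathcal H$ (for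 instance, for all $\Psi\in\mathcal H$): 1. On an open neighborhood of the mass shell $\{\kappa=0\}$, where $\kappa=k^0-\omega$ and $\omega=\sqrt{|\mathbf k|^2+m^2}$, the distribution $\hat w$ is given by a continuous function that has a continuous partial derivative with respect to $\kappa$ (at fixed $\mathbf k$). 2. The Yang–Feldman equations hold: with a fixed sign $\sigma\in\{1,-1\}$ (the convention distinguishing the Fourier transforms of the retarded and the advanced Green's function), $$\hat W=\lim_{\epsilon\downarrow0}\frac{\hat w}{k^2-m^2-i\sigma k^0\epsilon}+\hat W^{\rm in},\qquad \hat W=\lim_{\epsilon\downarrow0}\frac{\hat w}{k^2-m^2+i\sigma k^0\epsilon}+\hat W^{\rm out}$$ in the sense of distributions on momentum space (that is, tested with arbitrary smooth compactly supported functions). Suppose moreover that the outgoing field applied to the vacuum satisfies the Klein–Gordon equation $(-\partial_\nu\partial^\nu-m^2)\phi^{\rm out}(x)\Psi_0=0$. Then the one-particle states are stable: $$\phi^{\rm in}(x)\Psi_0=\phi^{\rm out}(x)\Psi_0$$ as vector-valued distributions. -/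

import Mathlib

open scoped SchwartzMap LineDeriv FourierTransform ContDiff Topology ComplexInnerProductSpace
open MeasureTheory Filter

noncomputable section

namespace YangFeldman

/-! ### Minkowski space -/

/-- Minkowski space (also used as momentum space); the coordinate `0` is the time (energy). The
Euclidean structure of the type only serves to name the topology and Lebesgue measure. -/
abbrev Spacetime : Type := EuclideanSpace ℝ (Fin 4)

/-- The Minkowski product `x · y`, of signature `(+, -, -, -)`. -/
def mdot (x y : Spacetime) : ℝ := x 0 * y 0 - x 1 * y 1 - x 2 * y 2 - x 3 * y 3

/-- The unit vector of the coordinate `μ`. -/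
def basisVec (μ : Fin 4) : Spacetime := EuclideanSpace.single μ 1

/-- The closed forward light cone. -/
def closedForwardCone : Set Spacetime := {p | 0 ≤ p 0 ∧ 0 ≤ mdot p p}

/-- The relativistic energy `ω = √(|𝐤|² + m²)`, a function of the spatial part of `k`. -/
def omega (m : ℝ) (k : Spacetime) : ℝ := √(k 1 ^ 2 + k 2 ^ 2 + k 3 ^ 2 + m ^ 2)

/-- The variable `κ = k⁰ - ω`. -/
def kappa (m : ℝ) (k : Spacetime) : ℝ := k 0 - omega m k

/-! ### The action of `SL(2, ℂ)` on Minkowski space -/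

/-- The Hermitian matrix `x⁰ + 𝐱 · σ` (with the Pauli matrices `σ`) of a point `x`. -/
def toHerm (x : Spacetime) : Matrix (Fin 2) (Fin 2) ℂ :=
  !![(x 0 : ℂ) + x 3, x 1 - Complex.I * x 2; x 1 + Complex.I * x 2, x 0 - x 3]

/-- The inverse of `toHerm` on Hermitian matrices. -/
def ofHerm (M : Matrix (Fin 2) (Fin 2) ℂ) : Spacetime :=
  !₂[((M 0 0).re + (M 1 1).re) / 2, (M 1 0).re, (M 1 0).im, ((M 0 0).re - (M 1 1).re) / 2]

theorem ofHerm_toHerm (x : Spacetime) : ofHerm (toHerm x) = x := by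
  ext i
  fin_cases i <;> simp [ofHerm, toHerm]

theorem toHerm_isHermitian (x : Spacetime) : (toHerm x).IsHermitian := by
  ext i j
  fin_cases i <;> fin_cases j <;> simp [toHerm, Complex.ext_iff]

theorem toHerm_ofHerm {M : Matrix (Fin 2) (Fin 2) ℂ} (hM : M.IsHermitian) :
    toHerm (ofHerm M) = M := by
  have h00 := congrArg Complex.im (hM.apply 0 0)
  have h11 := congrArg Complex.im (hM.apply 1 1)
  have h01 := hM.apply 0 1
  simp only [Complex.star_def, Complex.conj_im] at h00 h11
  ext i j
  fin_cases i <;> fin_cases j <;> simp [toHerm, ofHerm, Complex.ext_iff]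
  · constructor <;> linarith
  · rw [← h01]; simp
  · constructor <;> linarith

/-- The Lorentz transformation `x ↦ Λ(A) x` of `A`, given by
`toHerm (Λ(A) x) = A (toHerm x) Aᴴ`. -/
def lorentz (A : Matrix.SpecialLinearGroup (Fin 2) ℂ) (x : Spacetime) : Spacetime :=
  ofHerm (A.1 * toHerm x * A.1.conjTranspose)

theorem toHerm_lorentz (A : Matrix.SpecialLinearGroup (Fin 2) ℂ) (x : Spacetime) :
    toHerm (lorentz A x) = A.1 * toHerm x * A.1.conjTranspose :=
  toHerm_ofHerm (Matrix.isHermitian_mul_mul_conjTranspose _ (toHerm_isHermitian x))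

theorem toHerm_injective : Function.Injective toHerm :=
  Function.LeftInverse.injective ofHerm_toHerm

theorem lorentz_mul (A B : Matrix.SpecialLinearGroup (Fin 2) ℂ) (x : Spacetime) :
    lorentz (A * B) x = lorentz A (lorentz B x) := by
  apply toHerm_injective
  simp [toHerm_lorentz, Matrix.mul_assoc, Matrix.conjTranspose_mul]

theorem lorentz_one (x : Spacetime) : lorentz 1 x = x := by
  apply toHerm_injective
  simp [toHerm_lorentz]

theorem toHerm_add (x y : Spacetime) : toHerm (x + y) = toHerm x + toHerm y := by
  ext i j
  fin_cases i <;> fin_cases j <;> simp [toHerm] <;> ring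

theorem toHerm_smul (c : ℝ) (x : Spacetime) : toHerm (c • x) = (c : ℂ) • toHerm x := by
  ext i j
  fin_cases i <;> fin_cases j <;> simp [toHerm] <;> ring

/-- `Λ(A)` as a linear automorphism of Minkowski space. -/
def lorentzEquiv (A : Matrix.SpecialLinearGroup (Fin 2) ℂ) : Spacetime ≃L[ℝ] Spacetime :=
  LinearEquiv.toContinuousLinearEquiv
    { toFun := lorentz A
      invFun := lorentz A⁻¹
      map_add' := fun x y => by
        apply toHerm_injective
        simp [toHerm_lorentz, toHerm_add, Matrix.mul_add, Matrix.add_mul]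
      map_smul' := fun c x => by
        apply toHerm_injective
        simp [toHerm_lorentz, toHerm_smul]
      left_inv := fun x => by rw [← lorentz_mul, inv_mul_cancel, lorentz_one]
      right_inv := fun x => by rw [← lorentz_mul, mul_inv_cancel, lorentz_one] }

/-- The transformed test function `x ↦ f (Λ(A)⁻¹ (x - a))`. -/
def transport (a : Spacetime) (A : Matrix.SpecialLinearGroup (Fin 2) ℂ) (f : 𝓢(Spacetime, ℂ)) :
    𝓢(Spacetime, ℂ) :=
  SchwartzMap.compSubConstCLM ℂ a
    (SchwartzMap.compCLMOfContinuousLinearEquiv ℂ (lorentzEquiv A).symm f)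

theorem transport_apply (a : Spacetime) (A : Matrix.SpecialLinearGroup (Fin 2) ℂ)
    (f : 𝓢(Spacetime, ℂ)) (x : Spacetime) :
    transport a A f x = f (lorentz A⁻¹ (x - a)) := by
  rw [transport, SchwartzMap.compSubConstCLM_apply]
  rfl

/-! ### Operations on test functions -/

/-- The complex conjugate of a test function. -/
def conjS (f : 𝓢(Spacetime, ℂ)) : 𝓢(Spacetime, ℂ) :=
  SchwartzMap.postcompCLM (Complex.conjCLE : ℂ →L[ℝ] ℂ) f

theorem conjS_apply (f : 𝓢(Spacetime, ℂ)) (x : Spacetime) :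
    conjS f x = (starRingEnd ℂ) (f x) := by
  simp [conjS]

/-- The Klein-Gordon operator `-∂_ν ∂^ν - m²`. It is its own formal transpose. -/
def kleinGordon (m : ℝ) (f : 𝓢(Spacetime, ℂ)) : 𝓢(Spacetime, ℂ) :=
  -(∂_{basisVec 0} (∂_{basisVec 0} f) - ∂_{basisVec 1} (∂_{basisVec 1} f)
      - ∂_{basisVec 2} (∂_{basisVec 2} f) - ∂_{basisVec 3} (∂_{basisVec 3} f))
    - ((m ^ 2 : ℝ) : ℂ) • f

/-- The linear map `x ↦ (-1 / 2π) (x⁰, -𝐱)`, which turns Mathlib's Fourier kernel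
`exp (-2πi ⟪k, ξ⟫)` into `exp (i x · k)`. -/
def fourierScaling : Spacetime ≃L[ℝ] Spacetime :=
  LinearEquiv.toContinuousLinearEquiv
    { toFun := fun x => !₂[-(2 * Real.pi)⁻¹ * x 0, (2 * Real.pi)⁻¹ * x 1,
        (2 * Real.pi)⁻¹ * x 2, (2 * Real.pi)⁻¹ * x 3]
      invFun := fun x => !₂[-(2 * Real.pi) * x 0, (2 * Real.pi) * x 1,
        (2 * Real.pi) * x 2, (2 * Real.pi) * x 3]
      map_add' := fun x y => by
        ext i
        fin_cases i <;> simp <;> ring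
      map_smul' := fun c x => by
        ext i
        fin_cases i <;> simp <;> ring
      left_inv := fun x => by
        ext i
        fin_cases i <;> simp <;> field_simp
      right_inv := fun x => by
        ext i
        fin_cases i <;> simp <;> field_simp }

theorem fourierScaling_apply (x : Spacetime) :
    fourierScaling x = !₂[-(2 * Real.pi)⁻¹ * x 0, (2 * Real.pi)⁻¹ * x 1,
      (2 * Real.pi)⁻¹ * x 2, (2 * Real.pi)⁻¹ * x 3] := rfl

/-- The Fourier transform `x ↦ ∫ exp (i x · k) h(k) dk` with the Minkowski product. -/
def mFourier (h : 𝓢(Spacetime, ℂ)) : 𝓢(Spacetime, ℂ) :=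
  SchwartzMap.compCLMOfContinuousLinearEquiv ℂ fourierScaling (𝓕 h)

theorem mFourier_apply (h : 𝓢(Spacetime, ℂ)) (x : Spacetime) :
    mFourier h x = ∫ k : Spacetime, Complex.exp (Complex.I * (mdot x k : ℝ)) * h k := by
  have e : mFourier h x = (𝓕 h : 𝓢(Spacetime, ℂ)) (fourierScaling x) := rfl
  rw [e, SchwartzMap.fourier_coe, Real.fourier_eq']
  congr 1
  ext k
  rw [smul_eq_mul]
  congr 2
  have : inner ℝ k (fourierScaling x) = -(2 * Real.pi)⁻¹ * mdot x k := by
    simp [fourierScaling_apply, PiLp.inner_apply, Fin.sum_univ_four, mdot]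
    ring
  rw [this]
  push_cast
  have hpi : (Real.pi : ℂ) ≠ 0 := by exact_mod_cast Real.pi_ne_zero
  field_simp

/-- The regularized denominator `k² - m² - i η k⁰`. -/
def denominator (m η : ℝ) (k : Spacetime) : ℂ :=
  (mdot k k : ℂ) - (m : ℂ) ^ 2 - Complex.I * η * k 0

theorem denominator_ne_zero {m η : ℝ} (hm : m ≠ 0) (hη : η ≠ 0) (k : Spacetime) :
    denominator m η k ≠ 0 := by
  intro h
  have h1 := congrArg Complex.re h
  have h2 := congrArg Complex.im h
  simp [denominator, ← Complex.ofReal_pow, hη] at h1 h2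
  unfold mdot at h1
  rw [h2] at h1
  have : 0 < m ^ 2 := by positivity
  nlinarith [sq_nonneg (k 1), sq_nonneg (k 2), sq_nonneg (k 3)]

theorem contDiff_denominator (m η : ℝ) : ContDiff ℝ ∞ (denominator m η) := by
  have hc : ∀ i : Fin 4, ContDiff ℝ ∞ fun k : Spacetime => ((k i : ℝ) : ℂ) := fun i =>
    Complex.ofRealCLM.contDiff.comp (EuclideanSpace.proj (𝕜 := ℝ) i).contDiff
  have : denominator m η = fun k : Spacetime =>
      (((k 0 : ℝ) : ℂ) * k 0 - (k 1 : ℂ) * k 1 - (k 2 : ℂ) * k 2 - (k 3 : ℂ) * k 3)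
        - (m : ℂ) ^ 2 - Complex.I * η * k 0 := by
    ext k
    simp [denominator, mdot]
  rw [this]
  have h0 := hc 0
  have h1 := hc 1
  have h2 := hc 2
  have h3 := hc 3
  fun_prop

open Classical in
/-- The test function `k ↦ h(k) / (k² - m² - i η k⁰)`, for a compactly supported test function `h`,
`m ≠ 0` and `η ≠ 0` (see `divDenominator_apply`; the value outside of this range is irrelevant). -/
def divDenominator (m η : ℝ) (h : 𝓢(Spacetime, ℂ)) : 𝓢(Spacetime, ℂ) :=
  if H : HasCompactSupport h ∧ m ≠ 0 ∧ η ≠ 0 then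
    HasCompactSupport.toSchwartzMap (f := fun k => h k * (denominator m η k)⁻¹) H.1.mul_right
      ((h.smooth ⊤).mul
        ((contDiff_denominator m η).inv fun k => denominator_ne_zero H.2.1 H.2.2 k))
  else 0

theorem divDenominator_apply {m η : ℝ} (hm : m ≠ 0) (hη : η ≠ 0) {h : 𝓢(Spacetime, ℂ)}
    (hc : HasCompactSupport h) (k : Spacetime) :
    divDenominator m η h k = h k / denominator m η k := by
  rw [divDenominator, dif_pos ⟨hc, hm, hη⟩, div_eq_mul_inv]
  rfl

/-! ### Wightman fields -/

/-- A relativistic quantum field theory in the sense of Wightman, with a distinguished Hermitian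
scalar field `φ`, on a Hilbert space `H`. Mathlib's inner product is antilinear in the first
argument. The vacuum is not assumed to be cyclic for `φ`: the theory may contain further fields
(of any spin, whence the covering group `SL(2, ℂ)` of the restricted Lorentz group). -/
structure WightmanField (H : Type*) [NormedAddCommGroup H] [InnerProductSpace ℂ H]
    [CompleteSpace H] where
  /-- the unitary operators `U(a, A)` of the inhomogeneous `SL(2, ℂ)` -/
  U : Spacetime → Matrix.SpecialLinearGroup (Fin 2) ℂ → H ≃ₗᵢ[ℂ] H
  U_mul : ∀ a A b B Ψ, U a A (U b B Ψ) = U (a + lorentz A b) (A * B) Ψ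
  U_continuous : ∀ Ψ, Continuous fun p : Spacetime × Matrix.SpecialLinearGroup (Fin 2) ℂ =>
    U p.1 p.2 Ψ
  /-- spectrum condition: with `U(a, 1) = exp (i P · a)`, the joint spectrum of the energy-momentum
  operator `P` lies in the closed forward cone, that is, `∫ f(a) U(a, 1) da = 0` if the support of
  `p ↦ ∫ exp (i p · a) f(a) da` does not meet the cone -/
  spectrum : ∀ f : 𝓢(Spacetime, ℂ), Disjoint (tsupport (mFourier f)) closedForwardCone →
    ∀ Φ Ψ : H, ∫ a, f a * ⟪Φ, U a 1 Ψ⟫ = 0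
  /-- the vacuum `Ψ₀` -/
  vacuum : H
  norm_vacuum : ‖vacuum‖ = 1
  U_vacuum : ∀ a A, U a A vacuum = vacuum
  vacuum_unique : ∀ Ψ, (∀ a A, U a A Ψ = Ψ) → ∃ c : ℂ, Ψ = c • vacuum
  /-- the common domain of the smeared fields -/
  domain : Submodule ℂ H
  domain_dense : Dense (domain : Set H)
  vacuum_mem : vacuum ∈ domain
  U_mem : ∀ a A, ∀ Ψ ∈ domain, U a A Ψ ∈ domain
  /-- the smeared field `φ(f)` -/
  φ : 𝓢(Spacetime, ℂ) →ₗ[ℂ] domain →ₗ[ℂ] domain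
  φ_tempered : ∀ Φ Ψ : domain, Continuous fun f => ⟪(Φ : H), (φ f Ψ : H)⟫
  φ_hermitian : ∀ f, ∀ Φ Ψ : domain, ⟪(Φ : H), (φ f Ψ : H)⟫ = ⟪(φ (conjS f) Φ : H), (Ψ : H)⟫
  φ_covariant : ∀ a A f, ∀ Ψ : domain,
    U a A (φ f Ψ : H) = (φ (transport a A f) ⟨U a A Ψ, U_mem a A Ψ Ψ.2⟩ : H)
  /-- local commutativity: for `f` and `g` with space-like separated supports -/
  φ_local : ∀ f g : 𝓢(Spacetime, ℂ), (∀ x y, 0 ≤ mdot (x - y) (x - y) → f x * g y = 0) →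
    ∀ Ψ, φ f (φ g Ψ) = φ g (φ f Ψ)

variable {H : Type*} [NormedAddCommGroup H] [InnerProductSpace ℂ H]

/-- The vector-valued distribution `f ↦ φ(f) Ψ₀`. -/
def WightmanField.fieldVac [CompleteSpace H] (T : WightmanField H) (f : 𝓢(Spacetime, ℂ)) : H :=
  (T.φ f ⟨T.vacuum, T.vacuum_mem⟩ : H)

/-- The vector-valued distribution `f ↦ j(f) Ψ₀` of the current `j = (-∂_ν ∂^ν - m²) φ`. -/
def WightmanField.currentVac [CompleteSpace H] (T : WightmanField H) (m : ℝ)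
    (f : 𝓢(Spacetime, ℂ)) : H :=
  T.fieldVac (kleinGordon m f)

/-- The Fourier transform `∫ exp (i x · k) ⟨F(x), Ψ⟩ dx` of the matrix element `⟨F(x), Ψ⟩` of a
vector-valued distribution `F`, evaluated on the test function `h(k)`. As the inner product is
antilinear in `F`, the distribution `⟨F(x), Ψ⟩` is `f ↦ ⟨F(f̄), Ψ⟩`. -/
def matrixElementHat (F : 𝓢(Spacetime, ℂ) → H) (Ψ : H) (h : 𝓢(Spacetime, ℂ)) : ℂ :=
  ⟪F (conjS (mFourier h)), Ψ⟫

/-- On an open neighbourhood `V` of the mass shell `κ = 0`, the distribution `w` is a continuous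
function which is continuously differentiable in the variable `κ` (at fixed `𝐤`, where
`∂/∂κ = ∂/∂k⁰`). -/
def IsC1NearMassShell (m : ℝ) (w : 𝓢(Spacetime, ℂ) → ℂ) : Prop :=
  ∃ (V : Set Spacetime) (u u' : Spacetime → ℂ), IsOpen V ∧ {k | kappa m k = 0} ⊆ V ∧
    ContinuousOn u V ∧ ContinuousOn u' V ∧
    (∀ k ∈ V, HasLineDerivAt ℝ u (u' k) k (basisVec 0)) ∧
    ∀ h : 𝓢(Spacetime, ℂ), HasCompactSupport h → tsupport h ⊆ V → w h = ∫ k, u k * h k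

/-- The Yang-Feldman equation `Ŵ = ŵ / (k² - m² - i σ k⁰ ε) + Ŵ_free` in momentum space, with
`ε → 0+` and `σ = ±1`, as an equation between distributions (tested with smooth functions of compact
support); `Ŵ`, `ŵ`, `Ŵ_free` belong to the matrix elements of `F`, `J`, `Ffree` with `Ψ`. -/
def YangFeldmanEq (m σ : ℝ) (F J Ffree : 𝓢(Spacetime, ℂ) → H) (Ψ : H) : Prop :=
  ∀ h : 𝓢(Spacetime, ℂ), HasCompactSupport h →
    Tendsto (fun ε : ℝ => matrixElementHat J Ψ (divDenominator m (σ * ε) h)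
        + matrixElementHat Ffree Ψ h)
      (𝓝[>] 0) (𝓝 (matrixElementHat F Ψ h))

end YangFeldman

end

/-!
Positive definiteness makes the Fourier transform `φ̂(k)Ψ₀` behave like a vector-valued measure, and
a measure cannot produce a `δ` function on the mass shell. Subtracting the two Yang-Feldman
equations, and writing `d = k² - m²`, so that the current is `d φ̂`, one finds that
`Ŵ^out - Ŵ^in`, tested with `h`, is, up to sign, the limit `η → 0` of `Ŵ` tested with

  `d (1 / (d - i η k⁰) - 1 / (d + i η k⁰)) h = (2 i η k⁰ d / (d² + η² k₀²)) h`.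

The factor in front of `h` is bounded by `1` and tends to `0` pointwise, at `d = 0` as well, so by
dominated convergence the limit would vanish if `Ŵ` were a measure.

No spectral theorem is needed for this. Translation invariance of the two-point function
`⟪φ(f)Ψ₀, φ(g)Ψ₀⟫`, in infinitesimal form (`inner_fieldVac_lineDerivOp`), says that `d` and `k⁰` act
as symmetric operators. Hence `‖(d ∓ i η k⁰) v‖² = ‖d v‖² + η² ‖k⁰ v‖²`, which bounds the vectors
belonging to the test functions above, uniformly in `η` (`norm_currentVac_divDenominator_le`).
Up to a factor `i`, these vectors have the form `η k⁰ (u_η + u_{-η})` with `‖d u_{±η}‖` bounded, so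
their inner product with `d g` is `η ⟪d (u_η + u_{-η}), k⁰ g⟫ → 0`. They also lie in the span of the
vectors `d g`, so boundedness gives weak convergence to zero (`tendsto_inner_zero_of_mem_span`,
`tendsto_inner_currentVac_sub`). Everything is carried out in position space, where `d` is the
Klein-Gordon operator and `k⁰` is `∂₀` up to a factor `±i`.

Two general facts on the Schwartz space enter: difference quotients converge to the derivative in
its topology (`SchwartzMap.tendsto_smul_compSubConstCLM_sub`), and compactly supported functions are
dense (`SchwartzMap.dense_hasCompactSupport`), which extends the equality of `φ^in` and `φ^out` from
Fourier transforms of compactly supported functions to all test functions.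
-/

namespace SchwartzMap

/-! ### Translations and directional derivatives of Schwartz functions -/

section Translation

variable {E F : Type*} [NormedAddCommGroup E] [NormedSpace ℝ E] [NormedAddCommGroup F]
  [NormedSpace ℝ F]

theorem lineDerivOp_comm (v w : E) (f : 𝓢(E, F)) : ∂_{v} (∂_{w} f) = ∂_{w} (∂_{v} f) := by
  ext x
  have hd : DifferentiableAt ℝ (fderiv ℝ f) x :=
    (((f.smooth ⊤).fderiv_right (m := 1) (by norm_cast)).differentiable (by simp)) x
  have key : ∀ a b : E, (∂_{a} (∂_{b} f) : 𝓢(E, F)) x = fderiv ℝ (fderiv ℝ f) x a b := by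
    intro a b
    have hb : (∂_{b} f : 𝓢(E, F)) = (fun y => fderiv ℝ f y b : E → F) := by
      ext y
      exact lineDerivOp_apply_eq_fderiv b f y
    rw [lineDerivOp_apply_eq_fderiv, hb, fderiv_clm_apply hd (differentiableAt_const b)]
    simp
  rw [key, key]
  exact ((f.smooth 2).contDiffAt.isSymmSndFDerivAt (by simp)).eq v w

theorem lineDerivOp_iteratedLineDerivOp {n : ℕ} (e : E) (v : Fin n → E) (f : 𝓢(E, F)) :
    ∂_{e} (∂^{v} f) = ∂^{v} (∂_{e} f) := by
  induction n with
  | zero => simp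
  | succ n ih =>
    rw [LineDeriv.iteratedLineDerivOp_succ_left, LineDeriv.iteratedLineDerivOp_succ_left,
      lineDerivOp_comm, ih]

theorem fderiv_iteratedFDeriv_apply (n : ℕ) (f : 𝓢(E, F)) (x e : E) :
    fderiv ℝ (iteratedFDeriv ℝ n f) x e = iteratedFDeriv ℝ n (∂_{e} f : 𝓢(E, F)) x := by
  ext v
  rw [← iteratedLineDerivOp_eq_iteratedFDeriv, ← lineDerivOp_iteratedLineDerivOp,
    lineDerivOp_apply_eq_fderiv, ← fderiv_continuousMultilinear_apply_const_apply]
  · simp only [← iteratedLineDerivOp_eq_iteratedFDeriv]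
  · exact (f.smooth ⊤).differentiable_iteratedFDeriv (mod_cast ENat.natCast_lt_top n) x

theorem hasDerivAt_iteratedFDeriv_sub_smul (n : ℕ) (f : 𝓢(E, F)) (x e : E) (s : ℝ) :
    HasDerivAt (fun s : ℝ => iteratedFDeriv ℝ n f (x - s • e))
      (-iteratedFDeriv ℝ n (∂_{e} f : 𝓢(E, F)) (x - s • e)) s := by
  have hd : HasFDerivAt (iteratedFDeriv ℝ n f) (fderiv ℝ (iteratedFDeriv ℝ n f) (x - s • e))
      (x - s • e) :=
    ((f.smooth ⊤).differentiable_iteratedFDeriv (mod_cast ENat.natCast_lt_top n) _).hasFDerivAt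
  have hl : HasDerivAt (fun s : ℝ => x - s • e) (-e) s := by
    simpa using ((hasDerivAt_id s).smul_const e).const_sub x
  have := hd.comp_hasDerivAt s hl
  rwa [map_neg, fderiv_iteratedFDeriv_apply] at this

/-- The Schwartz seminorms are locally bounded under translations. -/
theorem exists_pow_mul_norm_iteratedFDeriv_sub_smul_le (k n : ℕ) (f : 𝓢(E, F)) (e : E) :
    ∃ C, 0 ≤ C ∧ ∀ (s : ℝ) (x : E), |s| ≤ 1 →
      ‖x‖ ^ k * ‖iteratedFDeriv ℝ n f (x - s • e)‖ ≤ C := by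
  refine ⟨2 ^ (k - 1) * (SchwartzMap.seminorm ℝ k n f + ‖e‖ ^ k * SchwartzMap.seminorm ℝ 0 n f),
    by positivity, fun s x hs => ?_⟩
  set y := x - s • e with hy
  have hx : ‖x‖ ≤ ‖y‖ + ‖e‖ := by
    calc ‖x‖ = ‖y + s • e‖ := by simp [hy]
      _ ≤ ‖y‖ + ‖s • e‖ := norm_add_le _ _
      _ ≤ ‖y‖ + ‖e‖ := by
        rw [norm_smul, Real.norm_eq_abs]
        gcongr
        exact mul_le_of_le_one_left (norm_nonneg e) hs
  calc ‖x‖ ^ k * ‖iteratedFDeriv ℝ n f y‖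
      ≤ (2 ^ (k - 1) * (‖y‖ ^ k + ‖e‖ ^ k)) * ‖iteratedFDeriv ℝ n f y‖ := by
        gcongr
        exact (pow_le_pow_left₀ (norm_nonneg x) hx k).trans
          (add_pow_le (norm_nonneg y) (norm_nonneg e) k)
    _ = 2 ^ (k - 1) * (‖y‖ ^ k * ‖iteratedFDeriv ℝ n f y‖
          + ‖e‖ ^ k * ‖iteratedFDeriv ℝ n f y‖) := by ring
    _ ≤ _ := by
        gcongr
        · exact f.le_seminorm ℝ k n y
        · exact f.norm_iteratedFDeriv_le_seminorm ℝ n y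

/-- The first-order Taylor remainder of a translation is quadratically small in every Schwartz
seminorm; this is the mean value inequality, applied twice. -/
theorem exists_pow_mul_norm_taylor_le (k n : ℕ) (f : 𝓢(E, F)) (e : E) :
    ∃ C, 0 ≤ C ∧ ∀ (t : ℝ) (x : E), |t| ≤ 1 →
      ‖x‖ ^ k * ‖iteratedFDeriv ℝ n f (x - t • e) - iteratedFDeriv ℝ n f x
        + t • iteratedFDeriv ℝ n (∂_{e} f : 𝓢(E, F)) x‖ ≤ C * t ^ 2 := by
  obtain ⟨C, hC, h⟩ := exists_pow_mul_norm_iteratedFDeriv_sub_smul_le k n (∂_{e} (∂_{e} f)) e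
  refine ⟨C, hC, fun t x ht => ?_⟩
  have hconv : Convex ℝ (Set.Icc (-|t|) |t|) := convex_Icc _ _
  have h0 : (0 : ℝ) ∈ Set.Icc (-|t|) |t| := by simp
  have hmem : ∀ {s : ℝ}, s ∈ Set.Icc (-|t|) |t| ↔ |s| ≤ |t| := fun {s} => abs_le.symm
  -- The remainder has derivative `∂_e f (x) - ∂_e f (x - s e)`, which is itself `O(s)`.
  have h1 : ∀ s ∈ Set.Icc (-|t|) |t|,
      ‖‖x‖ ^ k • (iteratedFDeriv ℝ n (∂_{e} f : 𝓢(E, F)) (x - s • e)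
        - iteratedFDeriv ℝ n (∂_{e} f : 𝓢(E, F)) x)‖ ≤ C * |t| := by
    intro s hs
    have := hconv.norm_image_sub_le_of_norm_hasDerivWithin_le
      (f := fun s : ℝ => ‖x‖ ^ k • iteratedFDeriv ℝ n (∂_{e} f : 𝓢(E, F)) (x - s • e))
      (fun r _ => ((hasDerivAt_iteratedFDeriv_sub_smul n (∂_{e} f) x e r).const_smul
        (‖x‖ ^ k)).hasDerivWithinAt) (C := C) (fun r hr => by
          rw [norm_smul, norm_neg, norm_pow, norm_norm]
          exact h r x ((hmem.1 hr).trans ht)) h0 hs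
    rw [← smul_sub] at this
    simp only [zero_smul, sub_zero, Real.norm_eq_abs] at this
    exact this.trans (mul_le_mul_of_nonneg_left (hmem.1 hs) hC)
  have h2 := hconv.norm_image_sub_le_of_norm_hasDerivWithin_le
    (f := fun s : ℝ => ‖x‖ ^ k • (iteratedFDeriv ℝ n f (x - s • e)
      + s • iteratedFDeriv ℝ n (∂_{e} f : 𝓢(E, F)) x))
    (fun r _ => (((hasDerivAt_iteratedFDeriv_sub_smul n f x e r).add
      ((hasDerivAt_id r).smul_const _)).const_smul (‖x‖ ^ k)).hasDerivWithinAt) (C := C * |t|)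
    (fun r hr => by
      refine (le_of_eq ?_).trans (h1 r hr)
      rw [← norm_neg, ← smul_neg, one_smul, neg_add, neg_neg, ← sub_eq_add_neg])
    h0 (y := t) (hmem.2 le_rfl)
  rw [← smul_sub, norm_smul, norm_pow, norm_norm] at h2
  simp only [zero_smul, sub_zero, add_zero, Real.norm_eq_abs] at h2
  rwa [← sq_abs t, pow_two, ← mul_assoc, sub_add_eq_add_sub]

/-- The difference quotients of a Schwartz function converge to its directional derivative in the
topology of the Schwartz space. -/
theorem tendsto_smul_compSubConstCLM_sub (𝕜 : Type*) [RCLike 𝕜] [NormedSpace 𝕜 F]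
    [SMulCommClass ℝ 𝕜 F] (f : 𝓢(E, F)) (e : E) :
    Tendsto (fun t : ℝ => t⁻¹ • (compSubConstCLM 𝕜 (t • e) f - f)) (𝓝[≠] 0) (𝓝 (-∂_{e} f)) := by
  rw [(schwartz_withSeminorms ℝ E F).tendsto_nhds]
  rintro ⟨k, n⟩ ε hε
  obtain ⟨C, hC, h⟩ := exists_pow_mul_norm_taylor_le k n f e
  have hsmall : ∀ᶠ t : ℝ in 𝓝[≠] 0, |t| ≤ 1 ∧ C * |t| < ε := by
    have : Tendsto (fun t : ℝ => C * |t|) (𝓝[≠] 0) (𝓝 0) := by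
      have : Continuous fun t : ℝ => C * |t| := by fun_prop
      simpa using (this.tendsto 0).mono_left nhdsWithin_le_nhds
    have h1 : Tendsto (fun t : ℝ => |t|) (𝓝[≠] 0) (𝓝 0) := by
      simpa using ((continuous_abs (G := ℝ)).tendsto 0).mono_left nhdsWithin_le_nhds
    exact ((h1.eventually_lt_const one_pos).mono fun _ => le_of_lt).and
      (this.eventually_lt_const hε)
  filter_upwards [hsmall, self_mem_nhdsWithin] with t ht ht0
  refine lt_of_le_of_lt (seminorm_le_bound ℝ k n _ (by positivity) fun x => ?_) ht.2
  have ht0 : t ≠ 0 := ht0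
  have hcd : ∀ g : 𝓢(E, F), ContDiffAt ℝ n g x := fun g => (g.smooth n).contDiffAt
  have hcds : ∀ (c : ℝ) (g : 𝓢(E, F)), ContDiffAt ℝ n (c • ⇑g) x :=
    fun c g => (hcd g).const_smul c
  have hsum : ContDiffAt ℝ n (⇑(compSubConstCLM 𝕜 (t • e) f) + (-1 : ℝ) • ⇑f) x :=
    (hcd _).add (hcds _ _)
  have hsum' : ContDiffAt ℝ n (⇑(compSubConstCLM 𝕜 (t • e) f) + (-1 : ℝ) • ⇑f
    + t • ⇑(∂_{e} f : 𝓢(E, F))) x := hsum.add (hcds _ _)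
  have hcoe : ((t⁻¹ • (compSubConstCLM 𝕜 (t • e) f - f) - -∂_{e} f : 𝓢(E, F)) : E → F)
      = t⁻¹ • ((compSubConstCLM 𝕜 (t • e) f : 𝓢(E, F)) + (-1 : ℝ) • ⇑f
        + t • ⇑(∂_{e} f : 𝓢(E, F))) := by
    ext y
    simp only [Pi.smul_apply, Pi.add_apply, sub_apply, neg_apply, smul_apply, smul_add, smul_sub,
      smul_smul, inv_mul_cancel₀ ht0]
    simp [sub_eq_add_neg]
  have htrans : iteratedFDeriv ℝ n (compSubConstCLM 𝕜 (t • e) f) x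
      = iteratedFDeriv ℝ n f (x - t • e) := iteratedFDeriv_comp_sub n (t • e) x
  rw [hcoe, iteratedFDeriv_const_smul_apply hsum',
    iteratedFDeriv_add_apply hsum (hcds _ _),
    iteratedFDeriv_add_apply (hcd _) (hcds _ _), iteratedFDeriv_const_smul_apply (hcd _),
    iteratedFDeriv_const_smul_apply (hcd _), htrans, norm_smul, neg_one_smul, ← sub_eq_add_neg,
    norm_inv, Real.norm_eq_abs, mul_left_comm, inv_mul_le_iff₀ (abs_pos.2 ht0)]
  refine (h t x ht.1).trans (le_of_eq ?_)
  rw [← sq_abs]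
  ring

end Translation

/-! ### Density of compactly supported functions -/

section Density

variable {E : Type*} [NormedAddCommGroup E] [InnerProductSpace ℝ E] [FiniteDimensional ℝ E]

/-- Smooth compactly supported functions are dense in the Schwartz space: cut off with
`χ(δ x)`, where `χ = 1` near `0`, and let `δ → 0`. -/
theorem dense_hasCompactSupport : Dense {f : 𝓢(E, ℂ) | HasCompactSupport f} := by
  intro f
  let χ : ContDiffBump (0 : E) := ⟨1, 2, one_pos, one_lt_two⟩
  let χc : E → ℂ := fun x => (χ x : ℂ)
  have hχc : ContDiff ℝ ∞ χc := Complex.ofRealCLM.contDiff.comp χ.contDiff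
  have hχs : HasCompactSupport χc := χ.hasCompactSupport.comp_left (g := fun r : ℝ => (r : ℂ)) rfl
  let ψ : ℝ → E → ℂ := fun δ x => χc (δ • x)
  have hψ : ∀ δ, ContDiff ℝ ∞ (ψ δ) := fun δ => hχc.comp (contDiff_const_smul δ)
  have hψs : ∀ δ, δ ≠ 0 → HasCompactSupport (ψ δ) := fun δ hδ =>
    hχs.comp_homeomorph (Homeomorph.smulOfNeZero δ hδ)
  have hc : ∀ δ, δ ≠ 0 → HasCompactSupport fun x => ψ δ x * f x :=
    fun δ hδ => (hψs δ hδ).mul_right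
  let g : ℝ → 𝓢(E, ℂ) := fun δ => if hδ : δ ≠ 0 then
    (hc δ hδ).toSchwartzMap ((hψ δ).mul (f.smooth ⊤)) else 0
  have hg : ∀ δ, δ ≠ 0 → ∀ x, g δ x = ψ δ x * f x := by
    intro δ hδ x
    simp only [g, dif_pos hδ]
    rfl
  -- All derivatives of `1 - χ(δ x)` are `O(δ (1 + |x|))`.
  have hbound : ∀ i : ℕ, ∃ C, 0 ≤ C ∧ ∀ (δ : ℝ) (x : E), 0 < δ → δ ≤ 1 →
      ‖iteratedFDeriv ℝ i (fun y => 1 - ψ δ y) x‖ ≤ C * (δ * (1 + ‖x‖)) := by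
    intro i
    rcases i with _ | i
    · refine ⟨1, zero_le_one, fun δ x h0 _ => ?_⟩
      rw [norm_iteratedFDeriv_zero]
      by_cases hx : ‖δ • x‖ ≤ 1
      · have : χ (δ • x) = 1 := χ.one_of_mem_closedBall (by simpa using hx)
        simp only [ψ, χc, this]
        simp
        positivity
      · have h1 : ‖(1 : ℂ) - ψ δ x‖ ≤ 1 := by
          have : (1 : ℂ) - ψ δ x = ((1 - χ (δ • x) : ℝ) : ℂ) := by simp [ψ, χc]
          rw [this, Complex.norm_real, Real.norm_eq_abs, abs_le]
          constructor <;> linarith [χ.nonneg (x := δ • x), χ.le_one (x := δ • x)]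
        rw [norm_smul, Real.norm_of_nonneg h0.le] at hx
        nlinarith [norm_nonneg x]
    · obtain ⟨C, hC⟩ := (hχc.continuous_iteratedFDeriv (m := i + 1)
        (mod_cast le_top)).bounded_above_of_compact_support (hχs.iteratedFDeriv (𝕜 := ℝ) (i + 1))
      have hC0 : 0 ≤ C := (norm_nonneg _).trans (hC 0)
      refine ⟨C, hC0, fun δ x h0 h1 => ?_⟩
      have e1 : iteratedFDeriv ℝ (i + 1) (fun y => 1 - ψ δ y) x
          = -iteratedFDeriv ℝ (i + 1) (ψ δ) x := by
        have : (fun y => 1 - ψ δ y) = (fun _ => (1 : ℂ)) + -(ψ δ) := by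
          ext y
          simp [sub_eq_add_neg]
        rw [this, iteratedFDeriv_add_apply contDiffAt_const
          (show ContDiffAt ℝ (i + 1 : ℕ) (-ψ δ) x from
            (hψ δ).neg.contDiffAt.of_le (mod_cast le_top)), iteratedFDeriv_neg_apply,
          iteratedFDeriv_const_of_ne (by simp)]
        simp
      have e2 : iteratedFDeriv ℝ (i + 1) (ψ δ) x
          = (iteratedFDeriv ℝ (i + 1) χc (δ • x)).compContinuousLinearMap
            fun _ => δ • ContinuousLinearMap.id ℝ E :=
        (δ • ContinuousLinearMap.id ℝ E).iteratedFDeriv_comp_right hχc x (mod_cast le_top)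
      have hn : ‖δ • ContinuousLinearMap.id ℝ E‖ ≤ δ := by
        rw [norm_smul, Real.norm_of_nonneg h0.le]
        exact mul_le_of_le_one_right h0.le ContinuousLinearMap.norm_id_le
      rw [e1, norm_neg, e2]
      calc _ ≤ ‖iteratedFDeriv ℝ (i + 1) χc (δ • x)‖
            * ∏ _j : Fin (i + 1), ‖δ • ContinuousLinearMap.id ℝ E‖ :=
            ContinuousMultilinearMap.norm_compContinuousLinearMap_le _ _
        _ ≤ C * δ := by
            rw [Finset.prod_const, Finset.card_univ, Fintype.card_fin]
            gcongr
            · exact hC _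
            · calc ‖δ • ContinuousLinearMap.id ℝ E‖ ^ (i + 1) ≤ δ ^ (i + 1) := by gcongr
                _ ≤ δ := pow_le_of_le_one h0.le h1 (by simp)
        _ ≤ C * (δ * (1 + ‖x‖)) := by
            gcongr
            nlinarith [norm_nonneg x]
  choose B hB0 hB using hbound
  have hlim : Tendsto g (𝓝[>] 0) (𝓝 f) := by
    rw [(schwartz_withSeminorms ℝ E ℂ).tendsto_nhds]
    rintro ⟨k, n⟩ ε hε
    let C : ℝ := ∑ i ∈ Finset.range (n + 1), (n.choose i : ℝ) * B i *
      (SchwartzMap.seminorm ℝ k (n - i) f + SchwartzMap.seminorm ℝ (k + 1) (n - i) f)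
    have hC : 0 ≤ C := Finset.sum_nonneg fun i _ => by have := hB0 i; positivity
    have hsmall : Tendsto (fun δ : ℝ => C * δ) (𝓝[>] 0) (𝓝 0) := by
      have : Continuous fun δ : ℝ => C * δ := by fun_prop
      simpa using (this.tendsto 0).mono_left nhdsWithin_le_nhds
    have hle : ∀ᶠ δ : ℝ in 𝓝[>] 0, δ ≤ 1 :=
      nhdsWithin_le_nhds (eventually_le_nhds one_pos)
    filter_upwards [hsmall.eventually_lt_const hε, hle, self_mem_nhdsWithin] with δ h1 h2 h3
    have h3 : 0 < δ := h3
    refine lt_of_le_of_lt (seminorm_le_bound ℝ k n _ (by positivity) fun x => ?_) h1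
    have hcoe : ((g δ - f : 𝓢(E, ℂ)) : E → ℂ) = -fun y => (1 - ψ δ y) * f y := by
      ext y
      simp only [sub_apply, hg δ h3.ne', Pi.neg_apply]
      ring
    rw [hcoe, iteratedFDeriv_neg_apply, norm_neg]
    calc _ ≤ ‖x‖ ^ k * ∑ i ∈ Finset.range (n + 1), (n.choose i : ℝ)
          * ‖iteratedFDeriv ℝ i (fun y => 1 - ψ δ y) x‖ * ‖iteratedFDeriv ℝ (n - i) f x‖ := by
          gcongr
          exact norm_iteratedFDeriv_mul_le (N := ∞) (contDiff_const.sub (hψ δ)) (f.smooth ⊤) x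
            (mod_cast le_top)
      _ ≤ ∑ i ∈ Finset.range (n + 1), (n.choose i : ℝ) * B i *
            (SchwartzMap.seminorm ℝ k (n - i) f + SchwartzMap.seminorm ℝ (k + 1) (n - i) f)
            * δ := by
          rw [Finset.mul_sum]
          refine Finset.sum_le_sum fun i _ => ?_
          have := hB0 i
          calc _ ≤ ‖x‖ ^ k * ((n.choose i : ℝ) * (B i * (δ * (1 + ‖x‖)))
                * ‖iteratedFDeriv ℝ (n - i) f x‖) := by
                gcongr
                exact hB i δ x h3 h2
            _ = (n.choose i : ℝ) * B i * (‖x‖ ^ k * ‖iteratedFDeriv ℝ (n - i) f x‖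
                + ‖x‖ ^ (k + 1) * ‖iteratedFDeriv ℝ (n - i) f x‖) * δ := by ring
            _ ≤ _ := by
                gcongr
                · exact f.le_seminorm ℝ k (n - i) x
                · exact f.le_seminorm ℝ (k + 1) (n - i) x
      _ = C * δ := by rw [← Finset.sum_mul]
  refine mem_closure_of_tendsto hlim ?_
  filter_upwards [self_mem_nhdsWithin] with δ hδ
  have hδ : δ ≠ 0 := ne_of_gt hδ
  have : (g δ : E → ℂ) = fun x => ψ δ x * f x := funext (hg δ hδ)
  change HasCompactSupport (g δ)
  rw [this]
  exact hc δ hδ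

end Density

end SchwartzMap

/-! ### Weak convergence to zero -/

/-- A bounded family in the closed span of `s` whose inner products with the elements of `s` tend
to zero tends weakly to zero. -/
theorem tendsto_inner_zero_of_mem_span {ι H : Type*} [NormedAddCommGroup H]
    [InnerProductSpace ℂ H] [CompleteSpace H] {l : Filter ι} {v : ι → H} {s : Set H} {C : ℝ}
    (hv : ∀ᶠ i in l, ‖v i‖ ≤ C) (hs : ∀ᶠ i in l, v i ∈ Submodule.span ℂ s)
    (h : ∀ x ∈ s, Tendsto (fun i => ⟪v i, x⟫) l (𝓝 0)) (Ψ : H) :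
    Tendsto (fun i => ⟪v i, Ψ⟫) l (𝓝 0) := by
  have hspan : ∀ x ∈ Submodule.span ℂ s, Tendsto (fun i => ⟪v i, x⟫) l (𝓝 0) := by
    intro x hx
    induction hx using Submodule.span_induction with
    | mem x hx => exact h x hx
    | zero => simpa using tendsto_const_nhds
    | add x y _ _ hx hy => simpa [inner_add_right] using hx.add hy
    | smul c x _ hx => simpa [inner_smul_right] using hx.const_mul c
  let K := (Submodule.span ℂ s).topologicalClosure
  have : CompleteSpace K := (Submodule.isClosed_topologicalClosure _).completeSpace_coe
  -- Only the projection of `Ψ` to the closed span matters; it is a limit of elements of the span.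
  obtain ⟨P, hP, hPΨ⟩ : ∃ P ∈ K, ∀ x ∈ K, ⟪x, Ψ⟫ = ⟪x, P⟫ := by
    refine ⟨K.starProjection Ψ, K.starProjection_apply_mem Ψ, fun x hx => ?_⟩
    rw [← sub_eq_zero, ← inner_sub_right]
    exact K.sub_starProjection_mem_orthogonal Ψ x hx
  have hC : 0 ≤ max C 0 := le_max_right _ _
  rw [Metric.tendsto_nhds]
  intro ε hε
  obtain ⟨x, hx, hxP⟩ := Metric.mem_closure_iff.1 hP (ε / 2 / (max C 0 + 1)) (by positivity)
  filter_upwards [hv, hs, Metric.tendsto_nhds.1 (hspan x hx) (ε / 2) (by positivity)]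
    with i h1 h2 h3
  rw [dist_zero_right] at h3 ⊢
  rw [hPΨ _ (Submodule.le_topologicalClosure _ h2)]
  rw [dist_eq_norm, lt_div_iff₀ (by positivity)] at hxP
  calc ‖⟪v i, P⟫‖ = ‖⟪v i, P - x⟫ + ⟪v i, x⟫‖ := by rw [inner_sub_right, sub_add_cancel]
    _ ≤ ‖⟪v i, P - x⟫‖ + ‖⟪v i, x⟫‖ := norm_add_le _ _
    _ ≤ ‖v i‖ * ‖P - x‖ + ‖⟪v i, x⟫‖ := by gcongr; exact norm_inner_le_norm _ _
    _ < ε / 2 + ε / 2 := by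
        refine add_lt_add_of_le_of_lt ?_ h3
        nlinarith [norm_nonneg (P - x), le_max_left C 0]
    _ = ε := add_halves ε

namespace YangFeldman

/-! ### Differential operators and the Fourier transform -/

theorem lineDerivOp_conjS (v : Spacetime) (f : 𝓢(Spacetime, ℂ)) :
    ∂_{v} (conjS f) = conjS (∂_{v} f) := by
  ext x
  have : (conjS f : Spacetime → ℂ) = Complex.conjCLE ∘ f := by
    ext y
    simp [conjS_apply]
  rw [SchwartzMap.lineDerivOp_apply_eq_fderiv, this, conjS_apply,
    SchwartzMap.lineDerivOp_apply_eq_fderiv, ContinuousLinearEquiv.comp_fderiv]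
  simp

theorem conjS_sub (f g : 𝓢(Spacetime, ℂ)) : conjS (f - g) = conjS f - conjS g :=
  map_sub (SchwartzMap.postcompCLM (Complex.conjCLE : ℂ →L[ℝ] ℂ)) f g

theorem conjS_neg (f : 𝓢(Spacetime, ℂ)) : conjS (-f) = -conjS f :=
  map_neg (SchwartzMap.postcompCLM (Complex.conjCLE : ℂ →L[ℝ] ℂ)) f

theorem conjS_ofReal_smul (c : ℝ) (f : 𝓢(Spacetime, ℂ)) :
    conjS ((c : ℂ) • f) = (c : ℂ) • conjS f := by
  ext x
  simp [conjS_apply]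

theorem conjS_conjS (f : 𝓢(Spacetime, ℂ)) : conjS (conjS f) = f := by
  ext x
  simp [conjS_apply]

theorem continuous_conjS : Continuous conjS :=
  (SchwartzMap.postcompCLM (Complex.conjCLE : ℂ →L[ℝ] ℂ)).continuous

theorem conjS_kleinGordon (m : ℝ) (f : 𝓢(Spacetime, ℂ)) :
    conjS (kleinGordon m f) = kleinGordon m (conjS f) := by
  simp only [kleinGordon, conjS_sub, conjS_neg, conjS_ofReal_smul, lineDerivOp_conjS]

theorem kleinGordon_add (m : ℝ) (f g : 𝓢(Spacetime, ℂ)) :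
    kleinGordon m (f + g) = kleinGordon m f + kleinGordon m g := by
  simp only [kleinGordon, LineDeriv.lineDerivOp_add, smul_add]
  abel

theorem kleinGordon_lineDerivOp (m : ℝ) (v : Spacetime) (f : 𝓢(Spacetime, ℂ)) :
    kleinGordon m (∂_{v} f) = ∂_{v} (kleinGordon m f) := by
  have hsub : ∀ f g : 𝓢(Spacetime, ℂ), ∂_{v} (f - g) = ∂_{v} f - ∂_{v} g := fun f g =>
    map_sub (LineDeriv.lineDerivOpCLM ℂ 𝓢(Spacetime, ℂ) v) f g
  simp only [kleinGordon, hsub, LineDeriv.lineDerivOp_neg, LineDeriv.lineDerivOp_smul]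
  simp only [SchwartzMap.lineDerivOp_comm v]

/-- `mFourier` as a continuous linear map. -/
noncomputable def mFourierCLM : 𝓢(Spacetime, ℂ) →L[ℂ] 𝓢(Spacetime, ℂ) :=
  SchwartzMap.compCLMOfContinuousLinearEquiv ℂ fourierScaling ∘L
    SchwartzMap.fourierTransformCLM ℂ

theorem mFourierCLM_apply (f : 𝓢(Spacetime, ℂ)) : mFourierCLM f = mFourier f := rfl

theorem mFourier_surjective : Function.Surjective mFourier := by
  intro f
  refine ⟨𝓕⁻ (SchwartzMap.compCLMOfContinuousLinearEquiv ℂ fourierScaling.symm f), ?_⟩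
  rw [mFourier, FourierTransform.fourier_fourierInv_eq]
  ext x
  simp

theorem hasTemperateGrowth_mdot (v : Spacetime) :
    (fun k : Spacetime => (mdot v k : ℂ)).HasTemperateGrowth := by
  have h : (fun k : Spacetime => (mdot v k : ℂ)) =
      ⇑(Complex.ofRealCLM ∘L (v 0 • EuclideanSpace.proj (𝕜 := ℝ) (0 : Fin 4)
        - v 1 • EuclideanSpace.proj (𝕜 := ℝ) (1 : Fin 4)
        - v 2 • EuclideanSpace.proj (𝕜 := ℝ) (2 : Fin 4)
        - v 3 • EuclideanSpace.proj (𝕜 := ℝ) (3 : Fin 4) : Spacetime →L[ℝ] ℝ)) := by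
    ext k
    simp [mdot]
  rw [h]
  exact ContinuousLinearMap.hasTemperateGrowth _

/-- Under the Fourier transform, `∂_v` becomes multiplication by `i v · k`. -/
theorem lineDerivOp_mFourier (v : Spacetime) (f : 𝓢(Spacetime, ℂ)) :
    ∂_{v} (mFourier f) = mFourier
      (Complex.I • SchwartzMap.smulLeftCLM ℂ (fun k : Spacetime => (mdot v k : ℂ)) f) := by
  rw [mFourier, mFourier, SchwartzMap.lineDerivOp_compCLMOfContinuousLinearEquiv,
    SchwartzMap.lineDerivOp_fourier_eq]
  congr 2
  ext k
  have hi : (inner ℝ · (fourierScaling v) : Spacetime → ℝ).HasTemperateGrowth :=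
    ((innerSL ℝ).flip (fourierScaling v)).hasTemperateGrowth
  have : inner ℝ k (fourierScaling v) = -(2 * Real.pi)⁻¹ * mdot v k := by
    simp [fourierScaling_apply, PiLp.inner_apply, Fin.sum_univ_four, mdot]
    ring
  rw [smul_apply, smul_apply, SchwartzMap.smulLeftCLM_apply_apply hi,
    SchwartzMap.smulLeftCLM_apply_apply (hasTemperateGrowth_mdot v), this]
  have hpi : (Real.pi : ℂ) ≠ 0 := by exact_mod_cast Real.pi_ne_zero
  simp only [Complex.real_smul, smul_eq_mul]
  push_cast
  field_simp

/-- Division by the regularized denominator is inverted by the operator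
`kleinGordon m - η ∂₀` in position space. -/
theorem mFourier_eq_kleinGordon_divDenominator {m η : ℝ} (hm : m ≠ 0) (hη : η ≠ 0)
    {h : 𝓢(Spacetime, ℂ)} (hc : HasCompactSupport h) :
    mFourier h = kleinGordon m (mFourier (divDenominator m η h))
      - (η : ℂ) • ∂_{basisVec 0} (mFourier (divDenominator m η h)) := by
  simp only [kleinGordon, lineDerivOp_mFourier]
  simp only [← mFourierCLM_apply]
  simp only [← map_sub mFourierCLM, ← map_smul mFourierCLM, ← map_neg mFourierCLM]
  congr 1
  ext k
  have hd := denominator_ne_zero hm hη k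
  simp only [sub_apply, neg_apply, smul_apply, smul_eq_mul,
    map_smul, SchwartzMap.smulLeftCLM_apply_apply (hasTemperateGrowth_mdot _),
    divDenominator_apply hm hη hc]
  field_simp
  simp [denominator, mdot, basisVec]
  exact Or.inl (by ring)

namespace WightmanField

variable {H : Type*} [NormedAddCommGroup H] [InnerProductSpace ℂ H] [CompleteSpace H]
  (T : WightmanField H)

/-! ### The two-point function -/

theorem fieldVac_add (f g : 𝓢(Spacetime, ℂ)) :
    T.fieldVac (f + g) = T.fieldVac f + T.fieldVac g := by
  simp [fieldVac]

theorem fieldVac_neg (f : 𝓢(Spacetime, ℂ)) : T.fieldVac (-f) = -T.fieldVac f := by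
  simp [fieldVac]

theorem fieldVac_sub (f g : 𝓢(Spacetime, ℂ)) :
    T.fieldVac (f - g) = T.fieldVac f - T.fieldVac g := by
  simp [fieldVac]

theorem fieldVac_smul (c : ℂ) (f : 𝓢(Spacetime, ℂ)) :
    T.fieldVac (c • f) = c • T.fieldVac f := by
  simp [fieldVac]

theorem U_fieldVac (a : Spacetime) (f : 𝓢(Spacetime, ℂ)) :
    T.U a 1 (T.fieldVac f) = T.fieldVac (SchwartzMap.compSubConstCLM ℂ a f) := by
  have ht : transport a 1 f = SchwartzMap.compSubConstCLM ℂ a f := by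
    ext x
    rw [transport_apply, inv_one, lorentz_one, SchwartzMap.compSubConstCLM_apply]
  have hcov := T.φ_covariant a 1 f ⟨T.vacuum, T.vacuum_mem⟩
  simp only [ht, T.U_vacuum] at hcov
  exact hcov

theorem inner_fieldVac_compSubConstCLM (a : Spacetime) (f g : 𝓢(Spacetime, ℂ)) :
    ⟪T.fieldVac (SchwartzMap.compSubConstCLM ℂ a f), T.fieldVac g⟫
      = ⟪T.fieldVac f, T.fieldVac (SchwartzMap.compSubConstCLM ℂ (-a) g)⟫ := by
  have hg : g = SchwartzMap.compSubConstCLM ℂ a (SchwartzMap.compSubConstCLM ℂ (-a) g) := by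
    ext x
    simp
  conv_lhs => rw [hg]
  rw [← U_fieldVac, ← U_fieldVac, LinearIsometryEquiv.inner_map_map]

theorem continuous_inner_fieldVac (f : 𝓢(Spacetime, ℂ)) :
    Continuous fun g => ⟪T.fieldVac f, T.fieldVac g⟫ :=
  T.φ_tempered (T.φ f ⟨T.vacuum, T.vacuum_mem⟩) ⟨T.vacuum, T.vacuum_mem⟩

/-- Infinitesimal translation invariance of the two-point function. -/
theorem inner_fieldVac_lineDerivOp (v : Spacetime) (f g : 𝓢(Spacetime, ℂ)) :
    ⟪T.fieldVac (∂_{v} f), T.fieldVac g⟫ = -⟪T.fieldVac f, T.fieldVac (∂_{v} g)⟫ := by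
  have hcont : ∀ f g : 𝓢(Spacetime, ℂ), Tendsto
      (fun t : ℝ => ⟪T.fieldVac g,
        T.fieldVac (t⁻¹ • (SchwartzMap.compSubConstCLM ℂ (t • v) f - f))⟫) (𝓝[≠] 0)
      (𝓝 (⟪T.fieldVac g, T.fieldVac (-∂_{v} f)⟫)) := fun f g =>
    ((T.continuous_inner_fieldVac g).tendsto _).comp
      (SchwartzMap.tendsto_smul_compSubConstCLM_sub ℂ f v)
  have hsmul : ∀ (t : ℝ) (f : 𝓢(Spacetime, ℂ)), t • f = (t : ℂ) • f := by
    intro t f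
    ext x
    simp
  have hneg : Tendsto (fun t : ℝ => -t) (𝓝[≠] 0) (𝓝[≠] 0) := by
    refine tendsto_nhdsWithin_iff.2 ⟨?_, ?_⟩
    · simpa using ((continuous_neg (G := ℝ)).tendsto 0).mono_left nhdsWithin_le_nhds
    · filter_upwards [self_mem_nhdsWithin] with t ht
      simpa using ht
  -- Translating `f` by `t v` amounts to translating `g` by `-t v`.
  have h1 := (Complex.continuous_conj.tendsto _).comp (hcont f g)
  have h2 := ((hcont g f).comp hneg).neg
  have heq : (fun t : ℝ => (starRingEnd ℂ) (⟪T.fieldVac g,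
        T.fieldVac (t⁻¹ • (SchwartzMap.compSubConstCLM ℂ (t • v) f - f))⟫))
      = fun t : ℝ => -⟪T.fieldVac f,
        T.fieldVac ((-t)⁻¹ • (SchwartzMap.compSubConstCLM ℂ ((-t) • v) g - g))⟫ := by
    ext t
    rw [inner_conj_symm, hsmul, hsmul, fieldVac_smul, fieldVac_smul, fieldVac_sub, fieldVac_sub,
      inner_smul_left, inner_smul_right, inner_sub_left, inner_sub_right,
      inner_fieldVac_compSubConstCLM, neg_smul, Complex.conj_ofReal, inv_neg]
    push_cast
    ring
  have h3 := tendsto_nhds_unique h1 (heq ▸ h2)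
  simp only [fieldVac_neg, inner_neg_right, map_neg, inner_conj_symm, neg_neg] at h3
  rw [← h3, neg_neg]

theorem inner_fieldVac_kleinGordon (m : ℝ) (f g : 𝓢(Spacetime, ℂ)) :
    ⟪T.fieldVac (kleinGordon m f), T.fieldVac g⟫
      = ⟪T.fieldVac f, T.fieldVac (kleinGordon m g)⟫ := by
  simp only [kleinGordon, fieldVac_sub, fieldVac_neg, fieldVac_smul, inner_sub_left,
    inner_sub_right, inner_neg_left, inner_neg_right, inner_smul_left, inner_smul_right,
    inner_fieldVac_lineDerivOp, neg_neg, Complex.conj_ofReal]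

theorem inner_kleinGordon_lineDerivOp (m : ℝ) (v : Spacetime) (f g : 𝓢(Spacetime, ℂ)) :
    ⟪T.fieldVac (kleinGordon m f), T.fieldVac (∂_{v} g)⟫
      = -⟪T.fieldVac (∂_{v} f), T.fieldVac (kleinGordon m g)⟫ := by
  rw [inner_fieldVac_kleinGordon, kleinGordon_lineDerivOp, inner_fieldVac_lineDerivOp, neg_neg]

/-- As `kleinGordon m` is symmetric and `∂_v` antisymmetric for the two-point function, the cross
terms in the square of the norm cancel. -/
theorem norm_fieldVac_kleinGordon_le (m η : ℝ) (v : Spacetime) (f : 𝓢(Spacetime, ℂ)) :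
    ‖T.fieldVac (kleinGordon m f)‖
      ≤ ‖T.fieldVac (kleinGordon m f - (η : ℂ) • ∂_{v} f)‖ := by
  rw [fieldVac_sub, fieldVac_smul]
  refine (sq_le_sq₀ (norm_nonneg _) (norm_nonneg _)).1 ?_
  have h := T.inner_kleinGordon_lineDerivOp m v f f
  have hre : (⟪T.fieldVac (kleinGordon m f), T.fieldVac (∂_{v} f)⟫).re = 0 := by
    have h' := congrArg Complex.re h
    rw [← inner_conj_symm (T.fieldVac (∂_{v} f)), Complex.neg_re, Complex.conj_re] at h'
    linarith
  have := norm_sub_sq (𝕜 := ℂ) (T.fieldVac (kleinGordon m f)) ((η : ℂ) • T.fieldVac (∂_{v} f))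
  rw [inner_smul_right] at this
  simp only [RCLike.re_eq_complex_re, Complex.re_ofReal_mul, hre] at this
  rw [this]
  nlinarith [sq_nonneg ‖(η : ℂ) • T.fieldVac (∂_{v} f)‖]

/-! ### The difference of the two Green's functions -/

variable {m : ℝ} {h : 𝓢(Spacetime, ℂ)}

theorem norm_currentVac_divDenominator_le (hm : m ≠ 0) {η : ℝ} (hη : η ≠ 0)
    (hc : HasCompactSupport h) :
    ‖T.currentVac m (conjS (mFourier (divDenominator m η h)))‖
      ≤ ‖T.fieldVac (conjS (mFourier h))‖ := by
  rw [mFourier_eq_kleinGordon_divDenominator hm hη hc, conjS_sub, conjS_kleinGordon,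
    conjS_ofReal_smul, ← lineDerivOp_conjS]
  exact T.norm_fieldVac_kleinGordon_le m η (basisVec 0) _

theorem tendsto_inner_currentVac_sub (hm : m ≠ 0) (hc : HasCompactSupport h) (Ψ : H) :
    Tendsto (fun η : ℝ => ⟪T.currentVac m (conjS (mFourier (divDenominator m η h)))
      - T.currentVac m (conjS (mFourier (divDenominator m (-η) h))), Ψ⟫) (𝓝[>] 0) (𝓝 0) := by
  let A : ℝ → 𝓢(Spacetime, ℂ) := fun η => conjS (mFourier (divDenominator m η h))
  let N := ‖T.fieldVac (conjS (mFourier h))‖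
  have hA : ∀ η, η ≠ 0 → ‖T.fieldVac (kleinGordon m (A η))‖ ≤ N := fun η hη =>
    T.norm_currentVac_divDenominator_le hm hη hc
  have hAeq : ∀ η, η ≠ 0 → conjS (mFourier h) = kleinGordon m (A η)
      - (η : ℂ) • ∂_{basisVec 0} (A η) := by
    intro η hη
    rw [mFourier_eq_kleinGordon_divDenominator hm hη hc, conjS_sub, conjS_kleinGordon,
      conjS_ofReal_smul, ← lineDerivOp_conjS]
  refine tendsto_inner_zero_of_mem_span (s := Set.range (T.currentVac m)) (C := N + N) ?_ ?_ ?_ Ψ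
  · filter_upwards [self_mem_nhdsWithin] with η hη
    have hη : η ≠ 0 := ne_of_gt hη
    exact (norm_sub_le _ _).trans (add_le_add (hA η hη) (hA (-η) (neg_ne_zero.2 hη)))
  · exact Eventually.of_forall fun η => Submodule.sub_mem _
      (Submodule.subset_span ⟨_, rfl⟩) (Submodule.subset_span ⟨_, rfl⟩)
  · rintro _ ⟨g, rfl⟩
    -- The difference is `η ∂₀ (A η + A (-η))`, and `∂₀` can be moved over to `g`.
    have hlim : Tendsto (fun η : ℝ => |η| * ((N + N) * ‖T.fieldVac (∂_{basisVec 0} g)‖))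
        (𝓝[>] 0) (𝓝 0) := by
      have : Continuous fun η : ℝ => |η| * ((N + N) * ‖T.fieldVac (∂_{basisVec 0} g)‖) := by
        fun_prop
      simpa using (this.tendsto 0).mono_left nhdsWithin_le_nhds
    refine squeeze_zero_norm' ?_ hlim
    filter_upwards [self_mem_nhdsWithin] with η hη
    have hη : η ≠ 0 := ne_of_gt hη
    have hdiff : T.currentVac m (A η) - T.currentVac m (A (-η))
        = (η : ℂ) • T.fieldVac (∂_{basisVec 0} (A η + A (-η))) := by
      have := (hAeq η hη).symm.trans (hAeq (-η) (neg_ne_zero.2 hη))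
      rw [sub_eq_iff_eq_add] at this
      rw [currentVac, currentVac, this, ← fieldVac_sub, ← fieldVac_smul]
      congr 1
      simp only [LineDeriv.lineDerivOp_add, smul_add, Complex.ofReal_neg, neg_smul]
      abel
    change ‖⟪T.currentVac m (A η) - T.currentVac m (A (-η)), T.currentVac m g⟫‖ ≤ _
    rw [hdiff, inner_smul_left, norm_mul, Complex.conj_ofReal, Complex.norm_real,
      Real.norm_eq_abs]
    refine mul_le_mul_of_nonneg_left ?_ (abs_nonneg η)
    rw [currentVac, ← norm_neg, ← inner_kleinGordon_lineDerivOp, kleinGordon_add, fieldVac_add]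
    refine (norm_inner_le_norm _ _).trans ?_
    gcongr
    exact (norm_add_le _ _).trans (add_le_add (hA η hη) (hA (-η) (neg_ne_zero.2 hη)))

end WightmanField

end YangFeldman

/-! ### Stability of the one-particle states -/

theorem theorem1 {H : Type*} [NormedAddCommGroup H] [InnerProductSpace ℂ H] [CompleteSpace H]
    (T : YangFeldman.WightmanField H) (m : ℝ) (hm : 0 < m) (σ : ℝ) (hσ : σ = 1 ∨ σ = -1)
    (φin φout : 𝓢(YangFeldman.Spacetime, ℂ) →L[ℂ] H)
    (D : Set H) (hD : Dense D)
    (hreg : ∀ Ψ ∈ D,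
      YangFeldman.IsC1NearMassShell m (YangFeldman.matrixElementHat (T.currentVac m) Ψ))
    (hin : ∀ Ψ ∈ D, YangFeldman.YangFeldmanEq m σ T.fieldVac (T.currentVac m) φin Ψ)
    (hout : ∀ Ψ ∈ D, YangFeldman.YangFeldmanEq m (-σ) T.fieldVac (T.currentVac m) φout Ψ)
    (hKG : ∀ f, φout (YangFeldman.kleinGordon m f) = 0) :
    φin = φout := by
  open YangFeldman in
  have hmat : ∀ h : 𝓢(Spacetime, ℂ), HasCompactSupport h → ∀ Ψ ∈ D,
      ⟪φin (conjS (mFourier h)), Ψ⟫ = ⟪φout (conjS (mFourier h)), Ψ⟫ := by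
    intro h hc Ψ hΨ
    have h1 := (hin Ψ hΨ h hc).sub (hout Ψ hΨ h hc)
    have h2 := T.tendsto_inner_currentVac_sub hm.ne' hc Ψ
    simp only [matrixElementHat, sub_self] at h1
    simp only [inner_sub_left] at h2
    -- For either sign, the terms with the current tend to zero in the difference.
    have h3 : Tendsto (fun ε : ℝ =>
        ⟪T.currentVac m (conjS (mFourier (divDenominator m (σ * ε) h))), Ψ⟫
        - ⟪T.currentVac m (conjS (mFourier (divDenominator m (-σ * ε) h))), Ψ⟫)
        (𝓝[>] 0) (𝓝 0) := by
      rcases hσ with rfl | rfl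
      · simpa using h2
      · simpa using h2.neg
    have h4 := h1.sub h3
    simp only [add_sub_add_comm, add_sub_cancel_left, sub_zero] at h4
    exact sub_eq_zero.1 (tendsto_nhds_unique tendsto_const_nhds h4)
  open YangFeldman in
  have hvec : ∀ h : 𝓢(Spacetime, ℂ), HasCompactSupport h →
      φin (conjS (mFourier h)) = φout (conjS (mFourier h)) := fun h hc =>
    hD.eq_of_inner_left ℂ fun Ψ hΨ => hmat h hc Ψ hΨ
  open YangFeldman in
  have hall : (fun h => φin (conjS (mFourier h))) = fun h => φout (conjS (mFourier h)) := by
    have hcont : Continuous fun h => conjS (mFourier h) :=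
      continuous_conjS.comp mFourierCLM.continuous
    exact Continuous.ext_on SchwartzMap.dense_hasCompactSupport (φin.continuous.comp hcont)
      (φout.continuous.comp hcont) hvec
  ext f
  obtain ⟨h, hh⟩ := YangFeldman.mFourier_surjective (YangFeldman.conjS f)
  have := congrFun hall h
  simpa only [hh, YangFeldman.conjS_conjS] using this
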